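/- Let $F:\mathbb{R}^n\rightrightarrows\mathbb{R}^n$ be a multifunction, let $\mathcal{K}\subset\mathbb{R}^n$ be closed (the target), and put $$h(x,\zeta)=\min_{v\in F(x)}\langle v,\zeta\rangle,\qquad H(x,p)=\max_{v\in F(x)}\langle v,p\rangle .$$ Assumption (F): (F1) $F(x)$ is nonempty, convex and compact for every $x$; (F2) for every compact $C\subset\mathbb{R}^n$ there is $L>0$ with $F(x)\subset F(y)+L|y-x|\,\bar B(0,1)$ for all $x,y\in C$; (F3) there is $\gamma>0$ with $|v|\le\gamma(1+|x|)$ for all $x\in\mathbb{R}^n$, $v\in F(x)$. Assumption (H): for every $r>0$, (H1) there is $c\ge 0$ such that for every $p$ with $|p|=1$ the function $H(\cdot,p)$ is semiconvex on the open ball $B(0,r)$ with constant $c$, that is, it is continuous there and $H(x+z,p)+H(x-z,p)-2H(x,p)\ge -c|z|^2$ whenever $[x-z,x+z]\subset B(0,r)$; (H2) $\nabla_pH(x,p)$ exists for all $x \in B(0,r)$, $p\ne 0$, and is Lipschitz in $x$ on $B(0,r)$ with a constant independent of $p\in\mathbb{R}^n\setminus\{0\}$. A trajectory on $[0,T]$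 is an absolutely continuous $x:[0,T]\to\mathbb{R}^n$ with $\dot x(t)\in F(x(t))$ for a.e. $t\in[0,T]$. The minimum time function $\mathcal{T}:\mathbb{R}^n\to[0,+\infty]$ is $0$ on $\mathcal{K}$, and for $x\notin\mathcal{K}$ $$\mathcal{T}(x)=\inf\{T>0:\ \text{there is a trajectory } y \text{ on } [0,T] \text{ with } y(0)=x,\ y(T)\in\mathcal{K}\}\qquad(\inf\emptyset=+\infty).$$ Its epigraph is $\mathrm{epi}(\mathcal{T})=\{(x,\beta)\in\mathbb{R}^n\times\mathbb{R}:\mathcal{T}(x)<+\infty,\ \beta\ge\mathcal{T}(x)\}$. For a set $S$ in a Euclidean space and $z\in S$, $N^P_S(z)$ is the set of all $v$ for which there is $\sigma\ge 0$ with $\langle v,y-z\rangle\le\sigma|y-z|^2$ for all $y\in S$. For $f$ Lipschitz around $x$, Clarke's generalized gradient of $f$ at $x$ is the convex hull of all limits $\lim_i\nabla f(y_i)$, where $y_i\to x$ and $f$ is differentiable at every $y_i$; $\partial_xH(x,p)$ is Clarke's generalized gradient of $H(\cdot,p)$ at $x$. **Theorem.** Assume (F) and (H). Let $x_0\notin\mathcal{K}$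 with $\mathcal{T}(x_0)<+\infty$, let $\bar x:[0,\mathcal{T}(x_0)]\to\mathbb{R}^n$ be an optimal trajectory for $x_0$ (a trajectory with $\bar x(0)=x_0$ and $\bar x(\mathcal{T}(x_0))\in\mathcal{K}$), and let $\bar p:[0,\mathcal{T}(x_0)]\to\mathbb{R}^n$ be absolutely continuous and such that $$\dot{\bar x}(s)=\nabla_pH(\bar x(s),\bar p(s)),\qquad -\dot{\bar p}(s)\in\partial_xH(\bar x(s),\bar p(s))\qquad\text{for a.e. } s\in[0,\mathcal{T}(x_0)],$$ where the first equation is required only at times $s$ with $\bar p(s)\neq 0$. Suppose that $$\big(-\bar p(0),h(x_0,-\bar p(0))\big)\in N^P_{\mathrm{epi}(\mathcal{T})}(x_0,\mathcal{T}(x_0)).$$ Then for all $t\in[0,\mathcal{T}(x_0))$, $$\big(-\bar p(t),h(\bar x(t),-\bar p(t))\big)\in N^P_{\mathrm{epi}(\mathcal{T})}\big(\bar x(t),\mathcal{T}(\bar x(t))\big),$$ and $h(\bar x(t),-\bar p(t))=h(x_0,-\bar p(0))$ for all $t\in[0,\mathcal{T}(x_0)]$. -/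

import Mathlib

open Set Filter Topology MeasureTheory

noncomputable section

namespace MinTime

/-! ### Nonsmooth analysis -/

/-- The proximal normal cone `N^P_K(x)` to `K` at a point `x ∈ K`
(there are no proximal normals at points outside `K`). -/
def proximalNormalCone {E : Type*} [NormedAddCommGroup E] [InnerProductSpace ℝ E]
    (K : Set E) (x : E) : Set E :=
  {v | x ∈ K ∧ ∃ σ : ℝ, 0 ≤ σ ∧ ∀ y ∈ K, inner ℝ v (y - x) ≤ σ * ‖y - x‖ ^ 2}

/-- The epigraph of a function with values in `[0, +∞]`, as a subset of `E × ℝ` equipped with the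
Euclidean product norm and inner product: the pairs `(x, β)` with `f x < +∞` and `β ≥ f x`. -/
def epigraph {E : Type*} (f : E → ENNReal) : Set (WithLp 2 (E × ℝ)) :=
  {q | f q.fst ≠ ⊤ ∧ (f q.fst).toReal ≤ q.snd}

/-- The Clarke generalized gradient of `f` at `x` (used for `f` Lipschitz around `x`): the convex
hull of all limits of gradients `∇ f (y i)` along sequences `y i → x` of differentiability
points. -/
def clarkeGradient {E : Type*} [NormedAddCommGroup E] [InnerProductSpace ℝ E] [CompleteSpace E]
    (f : E → ℝ) (x : E) : Set E :=
  convexHull ℝ {v | ∃ y : ℕ → E, (∀ i, DifferentiableAt ℝ f (y i)) ∧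
    Tendsto y atTop (𝓝 x) ∧ Tendsto (fun i => gradient f (y i)) atTop (𝓝 v)}

/-- `f` is semiconcave on `Ω` with semiconcavity constant `c`. -/
def SemiconcaveOn {E : Type*} [NormedAddCommGroup E] [NormedSpace ℝ E]
    (Ω : Set E) (f : E → ℝ) (c : ℝ) : Prop :=
  ContinuousOn f Ω ∧
    ∀ x h : E, segment ℝ (x - h) (x + h) ⊆ Ω → f (x + h) + f (x - h) - 2 * f x ≤ c * ‖h‖ ^ 2

/-- `f` is semiconvex on `Ω` with semiconvexity constant `c`. -/
def SemiconvexOn {E : Type*} [NormedAddCommGroup E] [NormedSpace ℝ E]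
    (Ω : Set E) (f : E → ℝ) (c : ℝ) : Prop :=
  SemiconcaveOn Ω (fun x => -f x) c

/-! ### Differential inclusions and the minimum time function -/

/-- `x` restricted to `[0, T]` is a trajectory of the differential inclusion `ẋ ∈ F(x)`: it is
absolutely continuous on `[0, T]` and `ẋ(t) ∈ F(x(t))` for almost every `t ∈ [0, T]`. -/
def IsTrajectory {n : ℕ} (F : EuclideanSpace ℝ (Fin n) → Set (EuclideanSpace ℝ (Fin n)))
    (T : ℝ) (x : ℝ → EuclideanSpace ℝ (Fin n)) : Prop :=
  AbsolutelyContinuousOnInterval x 0 T ∧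
    ∀ᵐ t ∂(volume.restrict (Icc 0 T)), ∃ v ∈ F (x t), HasDerivAt x v t

open Classical in
/-- The minimum time function with values in `[0, +∞]`: it is `0` on the target `K`, and off `K`
the infimum of the times `T > 0` at which some trajectory starting at `x` is in `K` (so `+∞` if
there is none). -/
def minTime {n : ℕ} (F : EuclideanSpace ℝ (Fin n) → Set (EuclideanSpace ℝ (Fin n)))
    (K : Set (EuclideanSpace ℝ (Fin n))) (x : EuclideanSpace ℝ (Fin n)) : ENNReal :=
  if x ∈ K then 0
  else sInf {τ | ∃ T : ℝ, 0 < T ∧ τ = ENNReal.ofReal T ∧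
    ∃ y : ℝ → EuclideanSpace ℝ (Fin n), IsTrajectory F T y ∧ y 0 = x ∧ y T ∈ K}

/-- `x` is an optimal trajectory for `x₀`: a trajectory on `[0, 𝒯(x₀)]` that starts at `x₀` and
is in the target at the time `𝒯(x₀)` (used when `𝒯(x₀) < +∞`). -/
def IsOptimalTrajectory {n : ℕ}
    (F : EuclideanSpace ℝ (Fin n) → Set (EuclideanSpace ℝ (Fin n)))
    (K : Set (EuclideanSpace ℝ (Fin n))) (x₀ : EuclideanSpace ℝ (Fin n))
    (x : ℝ → EuclideanSpace ℝ (Fin n)) : Prop :=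
  IsTrajectory F (minTime F K x₀).toReal x ∧ x 0 = x₀ ∧ x (minTime F K x₀).toReal ∈ K

/-! ### Hamiltonians -/

/-- The minimized Hamiltonian `h(x, ζ) = min_{v ∈ F(x)} ⟨v, ζ⟩`. -/
def minHamiltonian {n : ℕ} (F : EuclideanSpace ℝ (Fin n) → Set (EuclideanSpace ℝ (Fin n)))
    (x ζ : EuclideanSpace ℝ (Fin n)) : ℝ :=
  sInf ((fun v => inner ℝ v ζ) '' F x)

/-- The maximized Hamiltonian `H(x, p) = max_{v ∈ F(x)} ⟨v, p⟩`. -/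
def maxHamiltonian {n : ℕ} (F : EuclideanSpace ℝ (Fin n) → Set (EuclideanSpace ℝ (Fin n)))
    (x p : EuclideanSpace ℝ (Fin n)) : ℝ :=
  sSup ((fun v => inner ℝ v p) '' F x)

/-! ### Standing assumptions -/

/-- Assumption (F): nonempty convex compact values, local Lipschitz continuity, linear growth. -/
structure AssumptionF {n : ℕ}
    (F : EuclideanSpace ℝ (Fin n) → Set (EuclideanSpace ℝ (Fin n))) : Prop where
  nonempty : ∀ x, (F x).Nonempty
  convex : ∀ x, Convex ℝ (F x)
  compact : ∀ x, IsCompact (F x)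
  lipschitz : ∀ C : Set (EuclideanSpace ℝ (Fin n)), IsCompact C →
    ∃ L : ℝ, 0 < L ∧ ∀ x ∈ C, ∀ y ∈ C, ∀ v ∈ F x, ∃ w ∈ F y, ‖v - w‖ ≤ L * ‖y - x‖
  growth : ∃ γ : ℝ, 0 < γ ∧ ∀ x, ∀ v ∈ F x, ‖v‖ ≤ γ * (1 + ‖x‖)

/-- Assumption (H), for every `r > 0`: `H(·, p)` is semiconvex on the ball `B(0, r)` with a constant
that is the same for all unit vectors `p`; and `∇_p H(x, p)` exists for `p ≠ 0` and is Lipschitz in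
`x` on `B(0, r)`, uniformly in `p ≠ 0`. -/
structure AssumptionH {n : ℕ}
    (F : EuclideanSpace ℝ (Fin n) → Set (EuclideanSpace ℝ (Fin n))) : Prop where
  semiconvex : ∀ r : ℝ, 0 < r → ∃ c : ℝ, 0 ≤ c ∧ ∀ p : EuclideanSpace ℝ (Fin n), ‖p‖ = 1 →
    SemiconvexOn (Metric.ball 0 r) (fun x => maxHamiltonian F x p) c
  differentiable : ∀ x p : EuclideanSpace ℝ (Fin n), p ≠ 0 →
    DifferentiableAt ℝ (maxHamiltonian F x) p
  lipschitz_gradient : ∀ r : ℝ, 0 < r → ∃ L : ℝ, 0 ≤ L ∧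
    ∀ p : EuclideanSpace ℝ (Fin n), p ≠ 0 → ∀ x ∈ Metric.ball 0 r, ∀ y ∈ Metric.ball 0 r,
      ‖gradient (maxHamiltonian F x) p - gradient (maxHamiltonian F y) p‖ ≤ L * ‖x - y‖

/-- `(x, p)` solves on `[0, T]` the Hamiltonian inclusion
`ẋ(s) = ∇_p H(x(s), p(s))`, `-ṗ(s) ∈ ∂_x H(x(s), p(s))` for a.e. `s ∈ [0, T]`,
with `x` and `p` absolutely continuous. The first equation is imposed only at times with
`p(s) ≠ 0`, where the gradient is guaranteed to exist. -/
def SolvesHamiltonianInclusion {n : ℕ}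
    (F : EuclideanSpace ℝ (Fin n) → Set (EuclideanSpace ℝ (Fin n))) (T : ℝ)
    (x p : ℝ → EuclideanSpace ℝ (Fin n)) : Prop :=
  AbsolutelyContinuousOnInterval x 0 T ∧ AbsolutelyContinuousOnInterval p 0 T ∧
    ∀ᵐ s ∂(volume.restrict (Icc 0 T)),
      (p s ≠ 0 → HasDerivAt x (gradient (maxHamiltonian F (x s)) (p s)) s) ∧
      ∃ q, HasDerivAt p q s ∧ -q ∈ clarkeGradient (fun z => maxHamiltonian F z (p s)) (x s)

end MinTime

end

noncomputable section

namespace MinTime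

/-! ### Absolutely continuous arcs: monotonicity and Grönwall estimates. -/

section Analysis

variable {X Y Z : Type*} [PseudoMetricSpace X] [PseudoMetricSpace Y] [PseudoMetricSpace Z]

/-! Proximal normality is carried along `x` by comparison with nearby arcs driven by the same
adjoint arc `p`. Given an epigraph point `(y₀, β)` near `(x t, T - t)`, solve `ẏ = ∇_p H(y, p(s))`
backward from `y t = y₀`. Since `∇_p H(y, p)` is the maximizer of `⟨·, p⟩` over `F y`, this is a
trajectory, and (H2) with Grönwall gives `‖y - x‖ ≤ e^{Kt} ‖y₀ - x t‖` on `[0, t]`. By dynamic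
programming `(y 0, t + β)` lies in the epigraph, so the proximal inequality at time `0` applies to
it.

To return to time `t`, let `q` be the derivative of `p`. Almost everywhere the derivative of `⟨p, y
- x⟩` is `⟨q, y - x⟩ + H(y, p) - H(x, p)`. Semiconvexity and `-q ∈ ∂_x H(x, p)` bound it below by
`-c ‖p‖ ‖y - x‖²`, so the pairing loses only a quadratic term
(`SolvesHamiltonianInclusion.exists_trajectory`).

The last component of the normal does not move, because `h(x, -p) = -H(x, p)` and `H` is constant
along the arcs (`SolvesHamiltonianInclusion.maxHamiltonian_eq`). The degenerate case `p = 0`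
separates cleanly: by Grönwall `p` vanishes everywhere or nowhere. -/

theorem absolutelyContinuousOnInterval_of_dist_le {f : ℝ → X} {g : ℝ → Y} {h : ℝ → Z}
    {a b A B : ℝ} (hf : AbsolutelyContinuousOnInterval f a b)
    (hg : AbsolutelyContinuousOnInterval g a b)
    (hle : ∀ s ∈ uIcc a b, ∀ t ∈ uIcc a b,
      dist (h s) (h t) ≤ A * dist (f s) (f t) + B * dist (g s) (g t)) :
    AbsolutelyContinuousOnInterval h a b := by
  unfold AbsolutelyContinuousOnInterval at hf hg
  apply squeeze_zero' ?_ ?_ (by simpa using (hf.const_mul A).add (hg.const_mul B))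
  · exact Filter.Eventually.of_forall <| fun _ ↦ Finset.sum_nonneg (fun i hi ↦ dist_nonneg)
  rw [eventually_inf_principal]
  filter_upwards with (n, I) hnI
  simp only [Finset.mul_sum, ← Finset.sum_add_distrib]
  refine Finset.sum_le_sum fun i hi => ?_
  exact hle _ (hnI.1 i hi).1 _ (hnI.1 i hi).2

/-- The fundamental theorem of calculus for absolutely continuous functions. The Lipschitz, Grönwall
and pairing estimates below all come from a suitable choice of `g`. -/
theorem le_of_ae_hasDerivAt_nonneg {g : ℝ → ℝ} {a b : ℝ} (hab : a ≤ b)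
    (hg : AbsolutelyContinuousOnInterval g a b)
    (hd : ∀ᵐ s, s ∈ Icc a b → ∃ d, 0 ≤ d ∧ HasDerivAt g d s) : g a ≤ g b := by
  have h := hg.integral_deriv_eq_sub
  have : 0 ≤ ∫ x in a..b, deriv g x := by
    refine intervalIntegral.integral_nonneg_of_ae_restrict hab ?_
    rw [Filter.EventuallyLE, ae_restrict_iff' measurableSet_Icc]
    filter_upwards [hd] with s hs hsI
    obtain ⟨d, hd0, hd⟩ := hs hsI
    simpa [hd.deriv] using hd0
  linarith

variable {E : Type*} [NormedAddCommGroup E] [InnerProductSpace ℝ E]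

theorem absolutelyContinuousOnInterval_inner {f g : ℝ → E} {a b : ℝ}
    (hf : AbsolutelyContinuousOnInterval f a b) (hg : AbsolutelyContinuousOnInterval g a b) :
    AbsolutelyContinuousOnInterval (fun s => (inner ℝ (f s) (g s) : ℝ)) a b := by
  obtain ⟨C, hC⟩ := hf.exists_bound
  obtain ⟨D, hD⟩ := hg.exists_bound
  refine absolutelyContinuousOnInterval_of_dist_le (A := D) (B := C) hf hg fun s hs t ht => ?_
  have h1 : (inner ℝ (f s) (g s) : ℝ) - inner ℝ (f t) (g t) =
      inner ℝ (f s - f t) (g s) + inner ℝ (f t) (g s - g t) := by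
    rw [inner_sub_left, inner_sub_right]; ring
  rw [Real.dist_eq, h1, dist_eq_norm, dist_eq_norm]
  refine (abs_add_le _ _).trans (add_le_add ?_ ?_)
  · refine (abs_real_inner_le_norm _ _).trans ?_
    rw [mul_comm]
    exact mul_le_mul_of_nonneg_right (hD s hs) (norm_nonneg _)
  · refine (abs_real_inner_le_norm _ _).trans ?_
    exact mul_le_mul_of_nonneg_right (hC t ht) (norm_nonneg _)

theorem absolutelyContinuousOnInterval_of_contDiff {f : ℝ → ℝ} (hf : ContDiff ℝ 1 f) (a b : ℝ) :
    AbsolutelyContinuousOnInterval f a b :=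
  hf.contDiffOn.absolutelyContinuousOnInterval

theorem norm_sub_le_of_ae_hasDerivAt {f : ℝ → E} {a b M : ℝ} (hM : 0 ≤ M)
    (hf : AbsolutelyContinuousOnInterval f a b)
    (hd : ∀ᵐ s, s ∈ Icc a b → ∃ v, ‖v‖ ≤ M ∧ HasDerivAt f v s) {s t : ℝ} (hs : a ≤ s)
    (hst : s ≤ t) (ht : t ≤ b) : ‖f t - f s‖ ≤ M * (t - s) := by
  have hsub : Icc s t ⊆ Icc a b := Icc_subset_Icc hs ht
  have hf' : AbsolutelyContinuousOnInterval f s t := hf.mono (by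
    rw [uIcc_of_le hst, uIcc_of_le (hs.trans (hst.trans ht))]; exact hsub)
  set w := f t - f s with hw
  have hc : AbsolutelyContinuousOnInterval (fun _ : ℝ => w) s t :=
    contDiffOn_const.absolutelyContinuousOnInterval
  -- Testing against the fixed vector `w = f t - f s` makes the problem scalar; dividing by `‖w‖` at
  -- the end gives the bound.
  have key := le_of_ae_hasDerivAt_nonneg hst
    (g := fun r => (M * ‖w‖) * r - inner ℝ (f r) w)
    (((absolutelyContinuousOnInterval_of_contDiff (f := fun r => (M * ‖w‖) * r)
      (by fun_prop) s t)).sub (absolutelyContinuousOnInterval_inner hf' hc)) (by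
      filter_upwards [hd] with r hr hrI
      obtain ⟨v, hv, hv'⟩ := hr (hsub hrI)
      refine ⟨(M * ‖w‖) - inner ℝ v w, ?_, ?_⟩
      · have := real_inner_le_norm v w
        nlinarith [norm_nonneg w]
      · have h1 := (hasDerivAt_id r).const_mul (M * ‖w‖)
        have h2 := hv'.inner ℝ (hasDerivAt_const r w)
        exact (h1.sub h2).congr_deriv (by simp))
  have h3 : inner ℝ (f t) w - inner ℝ (f s) w = ‖w‖ ^ 2 := by
    rw [← inner_sub_left, ← hw, real_inner_self_eq_norm_sq]
  rcases (norm_nonneg w).eq_or_lt with h0 | h0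
  · rw [← h0] at key h3 ⊢
    exact mul_nonneg hM (by linarith)
  · have : ‖w‖ * ‖w‖ ≤ ‖w‖ * (M * (t - s)) := by
      nlinarith
    exact le_of_mul_le_mul_left this h0

/-- Grönwall's inequality for absolutely continuous functions, with the sign `σ` selecting
the direction of time. -/
theorem norm_sq_mul_exp_le {f : ℝ → E} {a b C σ : ℝ} (hf : AbsolutelyContinuousOnInterval f a b)
    (hd : ∀ᵐ s, s ∈ Icc a b → ∃ v, HasDerivAt f v s ∧ 0 ≤ σ * (C * ‖f s‖ ^ 2 + inner ℝ (f s) v))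
    {s t : ℝ} (hs : a ≤ s) (hst : s ≤ t) (ht : t ≤ b) :
    σ * (Real.exp (2 * C * s) * ‖f s‖ ^ 2) ≤ σ * (Real.exp (2 * C * t) * ‖f t‖ ^ 2) := by
  have hsub : Icc s t ⊆ Icc a b := Icc_subset_Icc hs ht
  have hf' : AbsolutelyContinuousOnInterval f s t := hf.mono (by
    rw [uIcc_of_le hst, uIcc_of_le (hs.trans (hst.trans ht))]; exact hsub)
  have key := le_of_ae_hasDerivAt_nonneg hst
    (g := fun r => σ * (Real.exp (2 * C * r) * inner ℝ (f r) (f r)))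
    (((absolutelyContinuousOnInterval_of_contDiff (f := fun r => Real.exp (2 * C * r))
      (by fun_prop) s t).mul (absolutelyContinuousOnInterval_inner hf' hf')).const_mul σ) (by
      filter_upwards [hd] with r hr hrI
      obtain ⟨v, hv', hv⟩ := hr (hsub hrI)
      have h1 : HasDerivAt (fun r => Real.exp (2 * C * r)) (Real.exp (2 * C * r) * (2 * C)) r := by
        simpa using ((hasDerivAt_id r).const_mul (2 * C)).exp
      refine ⟨_, ?_, (h1.mul (hv'.inner ℝ hv')).const_mul σ⟩
      rw [real_inner_comm (f r) v, real_inner_self_eq_norm_sq]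
      have h2 : σ * (Real.exp (2 * C * r) * (2 * C) * ‖f r‖ ^ 2 + Real.exp (2 * C * r) *
        (inner ℝ (f r) v + inner ℝ (f r) v)) = Real.exp (2 * C * r) * 2 *
        (σ * (C * ‖f r‖ ^ 2 + inner ℝ (f r) v)) := by ring
      rw [h2]
      exact mul_nonneg (mul_nonneg (Real.exp_pos _).le two_pos.le) hv)
  simpa only [real_inner_self_eq_norm_sq] using key

end Analysis

/-! ### The maximized Hamiltonian and its gradient in the adjoint variable. -/

section Hamiltonian

variable {n : ℕ} {F : EuclideanSpace ℝ (Fin n) → Set (EuclideanSpace ℝ (Fin n))}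

theorem AssumptionF.isGreatest_maxHamiltonian (hF : AssumptionF F)
    (x p : EuclideanSpace ℝ (Fin n)) :
    IsGreatest ((fun v => (inner ℝ v p : ℝ)) '' F x) (maxHamiltonian F x p) :=
  ((hF.compact x).image (by fun_prop)).isGreatest_sSup ((hF.nonempty x).image _)

theorem AssumptionF.exists_maximizer (hF : AssumptionF F) (x p : EuclideanSpace ℝ (Fin n)) :
    ∃ v ∈ F x, (inner ℝ v p : ℝ) = maxHamiltonian F x p :=
  (hF.isGreatest_maxHamiltonian x p).1

theorem AssumptionF.inner_le_maxHamiltonian (hF : AssumptionF F)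
    {x v : EuclideanSpace ℝ (Fin n)} (hv : v ∈ F x) (p : EuclideanSpace ℝ (Fin n)) :
    (inner ℝ v p : ℝ) ≤ maxHamiltonian F x p :=
  (hF.isGreatest_maxHamiltonian x p).2 ⟨v, hv, rfl⟩

theorem AssumptionF.minHamiltonian_neg (hF : AssumptionF F) (x p : EuclideanSpace ℝ (Fin n)) :
    minHamiltonian F x (-p) = -maxHamiltonian F x p := by
  refine IsLeast.csInf_eq ⟨?_, ?_⟩
  · obtain ⟨v, hv, h⟩ := hF.exists_maximizer x p
    exact ⟨v, hv, by simp [h]⟩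
  · rintro _ ⟨v, hv, rfl⟩
    simpa using hF.inner_le_maxHamiltonian hv p

theorem AssumptionF.maxHamiltonian_smul (hF : AssumptionF F) (x p : EuclideanSpace ℝ (Fin n))
    {c : ℝ} (hc : 0 ≤ c) : maxHamiltonian F x (c • p) = c * maxHamiltonian F x p := by
  refine IsGreatest.csSup_eq ⟨?_, ?_⟩
  · obtain ⟨v, hv, h⟩ := hF.exists_maximizer x p
    exact ⟨v, hv, by simp [inner_smul_right, h]⟩
  · rintro _ ⟨v, hv, rfl⟩
    simpa [inner_smul_right] using mul_le_mul_of_nonneg_left (hF.inner_le_maxHamiltonian hv p) hc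

theorem AssumptionF.exists_norm_bound (hF : AssumptionF F) (R : ℝ) :
    ∃ M : ℝ, 0 ≤ M ∧ ∀ x ∈ Metric.closedBall (0 : EuclideanSpace ℝ (Fin n)) R, ∀ v ∈ F x,
      ‖v‖ ≤ M := by
  obtain ⟨γ, hγ, h⟩ := hF.growth
  refine ⟨γ * (1 + |R|), by positivity, fun x hx v hv => (h x v hv).trans ?_⟩
  have : ‖x‖ ≤ |R| := (mem_closedBall_zero_iff.1 hx).trans (le_abs_self R)
  gcongr

theorem AssumptionF.abs_maxHamiltonian_sub_le_right (hF : AssumptionF F)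
    {x : EuclideanSpace ℝ (Fin n)} {M : ℝ} (hM : ∀ v ∈ F x, ‖v‖ ≤ M)
    (p q : EuclideanSpace ℝ (Fin n)) :
    |maxHamiltonian F x p - maxHamiltonian F x q| ≤ M * ‖p - q‖ := by
  have key : ∀ p q, maxHamiltonian F x p - maxHamiltonian F x q ≤ M * ‖p - q‖ := fun p q => by
    obtain ⟨v, hv, h⟩ := hF.exists_maximizer x p
    have h1 := hF.inner_le_maxHamiltonian hv q
    have h2 : (inner ℝ v (p - q) : ℝ) ≤ M * ‖p - q‖ := (real_inner_le_norm _ _).trans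
      (mul_le_mul_of_nonneg_right (hM v hv) (norm_nonneg _))
    rw [inner_sub_right] at h2
    linarith
  rw [abs_le]
  have := key q p
  rw [norm_sub_rev] at this
  exact ⟨by linarith, key p q⟩

theorem AssumptionF.exists_lipschitz_maxHamiltonian (hF : AssumptionF F) (R : ℝ) :
    ∃ L : ℝ, 0 ≤ L ∧ ∀ x ∈ Metric.closedBall (0 : EuclideanSpace ℝ (Fin n)) R,
      ∀ y ∈ Metric.closedBall (0 : EuclideanSpace ℝ (Fin n)) R, ∀ p,
      |maxHamiltonian F x p - maxHamiltonian F y p| ≤ L * ‖p‖ * ‖x - y‖ := by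
  obtain ⟨L, hL, h⟩ := hF.lipschitz _ (isCompact_closedBall (0 : EuclideanSpace ℝ (Fin n)) R)
  have key : ∀ x ∈ Metric.closedBall (0 : EuclideanSpace ℝ (Fin n)) R,
      ∀ y ∈ Metric.closedBall (0 : EuclideanSpace ℝ (Fin n)) R, ∀ p,
      maxHamiltonian F x p - maxHamiltonian F y p ≤ L * ‖p‖ * ‖x - y‖ := fun x hx y hy p => by
    obtain ⟨v, hv, h1⟩ := hF.exists_maximizer x p
    obtain ⟨w, hw, h2⟩ := h x hx y hy v hv
    have h3 := hF.inner_le_maxHamiltonian hw p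
    have h4 : (inner ℝ (v - w) p : ℝ) ≤ L * ‖y - x‖ * ‖p‖ := (real_inner_le_norm _ _).trans
      (mul_le_mul_of_nonneg_right h2 (norm_nonneg _))
    rw [inner_sub_left, norm_sub_rev] at h4
    linarith
  refine ⟨L, hL.le, fun x hx y hy p => abs_le.2 ⟨?_, key x hx y hy p⟩⟩
  have := key y hy x hx p
  rw [norm_sub_rev] at this
  linarith

/-- The function `q ↦ H(x, q) - ⟨v, q⟩` is nonnegative and vanishes at `p`, so its derivative there
is zero. In particular the maximizer is unique. -/
theorem gradient_eq_of_isMaximizer (hF : AssumptionF F) (hH : AssumptionH F)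
    {x p v : EuclideanSpace ℝ (Fin n)} (hp : p ≠ 0) (hv : v ∈ F x)
    (h : (inner ℝ v p : ℝ) = maxHamiltonian F x p) : gradient (maxHamiltonian F x) p = v := by
  have hg := (hH.differentiable x p hp).hasGradientAt.hasFDerivAt
  have hmin : IsLocalMin (fun q => maxHamiltonian F x q - innerSL ℝ v q) p :=
    Filter.Eventually.of_forall fun q => by
      have := hF.inner_le_maxHamiltonian hv q
      simp only [innerSL_apply_apply]; linarith
  have h0 := hmin.hasFDerivAt_eq_zero (hg.sub (innerSL ℝ v).hasFDerivAt)
  refine ext_inner_right ℝ fun q => ?_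
  have := congrArg (fun φ : EuclideanSpace ℝ (Fin n) →L[ℝ] ℝ => φ q) h0
  simpa [sub_eq_zero] using this

theorem gradient_mem (hF : AssumptionF F) (hH : AssumptionH F)
    (x : EuclideanSpace ℝ (Fin n)) {p : EuclideanSpace ℝ (Fin n)} (hp : p ≠ 0) :
    gradient (maxHamiltonian F x) p ∈ F x := by
  obtain ⟨v, hv, h⟩ := hF.exists_maximizer x p
  rwa [gradient_eq_of_isMaximizer hF hH hp hv h]

theorem inner_gradient_self (hF : AssumptionF F) (hH : AssumptionH F)
    (x : EuclideanSpace ℝ (Fin n)) {p : EuclideanSpace ℝ (Fin n)} (hp : p ≠ 0) :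
    (inner ℝ (gradient (maxHamiltonian F x) p) p : ℝ) = maxHamiltonian F x p := by
  obtain ⟨v, hv, h⟩ := hF.exists_maximizer x p
  rwa [gradient_eq_of_isMaximizer hF hH hp hv h]

theorem continuous_maxHamiltonian_right (hF : AssumptionF F) (x : EuclideanSpace ℝ (Fin n)) :
    Continuous (maxHamiltonian F x) := by
  obtain ⟨M, hM0, hM⟩ := hF.exists_norm_bound ‖x‖
  refine (LipschitzWith.of_dist_le_mul (K := M.toNNReal) fun p q => ?_).continuous
  rw [Real.dist_eq, dist_eq_norm, Real.coe_toNNReal _ hM0]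
  exact hF.abs_maxHamiltonian_sub_le_right (hM x (by simp)) p q

/-- Gradients stay in the compact set `F x`, and any cluster point is a maximizer at `p`, hence the
gradient itself. -/
theorem continuousAt_gradient (hF : AssumptionF F) (hH : AssumptionH F)
    (x : EuclideanSpace ℝ (Fin n)) {p : EuclideanSpace ℝ (Fin n)} (hp : p ≠ 0) :
    ContinuousAt (gradient (maxHamiltonian F x)) p := by
  have hne : ∀ᶠ q in 𝓝 p, q ≠ 0 := isOpen_ne.mem_nhds hp
  refine (hF.compact x).tendsto_nhds_of_unique_mapClusterPt
    (hne.mono fun q hq => gradient_mem hF hH x hq) fun w hw hcl => ?_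
  refine (gradient_eq_of_isMaximizer hF hH hp hw ?_).symm
  obtain ⟨U, hU, hUw⟩ := mapClusterPt_iff_ultrafilter.1 hcl
  have h1 : Tendsto (fun q => (inner ℝ (gradient (maxHamiltonian F x) q) q : ℝ)) U
      (𝓝 (inner ℝ w p)) := hUw.inner hU
  have h2 : Tendsto (fun q => maxHamiltonian F x q) U (𝓝 (maxHamiltonian F x p)) :=
    ((continuous_maxHamiltonian_right hF x).tendsto p).mono_left hU
  refine tendsto_nhds_unique h1 (h2.congr' ?_)
  exact (hne.filter_mono hU).mono fun q hq => (inner_gradient_self hF hH x hq).symm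

end Hamiltonian

/-! ### Clarke gradients of semiconvex functions. -/

section Clarke

variable {E : Type*} [NormedAddCommGroup E] [InnerProductSpace ℝ E]

/-- The first-order lower bound at a point of differentiability of a function whose second
differences are at least `-c ‖z‖ ^ 2`. -/
theorem inner_gradient_le_of_second_difference [CompleteSpace E] {f : E → ℝ} {Ω : Set E} {c : ℝ}
    (hΩ : Convex ℝ Ω) (hc : 0 ≤ c)
    (hf : ∀ x h : E, segment ℝ (x - h) (x + h) ⊆ Ω → -(c * ‖h‖ ^ 2) ≤ f (x + h) + f (x - h) - 2 * f x)
    {x y : E} (hx : x ∈ Ω) (hy : y ∈ Ω) (hd : DifferentiableAt ℝ f x) :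
    (inner ℝ (gradient f x) (y - x) : ℝ) - c * ‖y - x‖ ^ 2 ≤ f y - f x := by
  set w := y - x with hw
  -- Bisection: the second difference centred at `x + a • w` with step `a • w` compares the
  -- difference quotients at scales `2a` and `a`, with error `c a ‖w‖² / 2`. The errors sum to at
  -- most `c ‖w‖²`, and the quotients tend to the directional derivative.
  have hk : ∀ k : ℕ, (2 : ℝ) ^ k * (f (x + ((2 : ℝ) ^ k)⁻¹ • w) - f x)
      - c * (1 - ((2 : ℝ) ^ k)⁻¹) * ‖w‖ ^ 2 ≤ f y - f x := by
    intro k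
    induction k with
    | zero => simp [hw]
    | succ k ih =>
      refine le_trans ?_ ih
      set a : ℝ := ((2 : ℝ) ^ (k + 1))⁻¹ with ha
      have ha0 : 0 < a := by positivity
      have ha1 : 2 * a ≤ 1 := by
        rw [ha, pow_succ, mul_inv]
        have : ((2 : ℝ) ^ k)⁻¹ ≤ 1 := inv_le_one_of_one_le₀ (one_le_pow₀ (by norm_num))
        linarith
      have hak : ((2 : ℝ) ^ k)⁻¹ = 2 * a := by
        rw [ha, pow_succ, mul_inv]; ring
      have h2 : (2 : ℝ) ^ (k + 1) = a⁻¹ := by rw [ha, inv_inv]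
      have h3 : (2 : ℝ) ^ k = a⁻¹ / 2 := by rw [← h2, pow_succ]; ring
      have hseg : segment ℝ (x + a • w - a • w) (x + a • w + a • w) ⊆ Ω := by
        refine hΩ.segment_subset (by simpa using hx) ?_
        have : x + a • w + a • w = x + (2 * a) • (y - x) := by
          rw [add_assoc, ← add_smul, two_mul]
        rw [this]
        exact hΩ.add_smul_sub_mem hx hy ⟨by positivity, ha1⟩
      have := hf _ _ hseg
      have e1 : x + a • w + a • w = x + (2 * a) • w := by
        rw [add_assoc, ← add_smul, two_mul]
      rw [e1, add_sub_cancel_right, norm_smul, mul_pow, Real.norm_eq_abs, sq_abs] at this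
      rw [hak, h2, h3]
      have h4 : a⁻¹ / 2 * (2 * (f (x + a • w) - f x)) ≤
          a⁻¹ / 2 * (f (x + (2 * a) • w) - f x + c * (a ^ 2 * ‖w‖ ^ 2)) :=
        mul_le_mul_of_nonneg_left (by linarith) (by positivity)
      have h5 : a⁻¹ / 2 * (c * (a ^ 2 * ‖w‖ ^ 2)) = c * a * ‖w‖ ^ 2 / 2 := by
        field_simp
      have h6 : 0 ≤ c * a * ‖w‖ ^ 2 := by positivity
      nlinarith
  have hline : HasDerivAt (fun t : ℝ => f (x + t • w)) (inner ℝ (gradient f x) w) 0 := by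
    have h1 : HasFDerivAt f (InnerProductSpace.toDual ℝ E (gradient f x)) (x + (0 : ℝ) • w) := by
      simpa using hd.hasGradientAt.hasFDerivAt
    have h2 : HasDerivAt (fun t : ℝ => x + t • w) w 0 := by
      simpa using ((hasDerivAt_id (0 : ℝ)).smul_const w).const_add x
    exact (h1.comp_hasDerivAt (0 : ℝ) h2).congr_deriv (by simp)
  have ht : Tendsto (fun k : ℕ => ((2 : ℝ) ^ k)⁻¹) atTop (𝓝[≠] 0) := by
    refine tendsto_nhdsWithin_iff.2 ⟨?_, Eventually.of_forall fun k => by simp⟩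
    simpa using tendsto_pow_atTop_nhds_zero_of_lt_one (r := (2 : ℝ)⁻¹) (by norm_num) (by norm_num)
  have hlim := (hline.tendsto_slope.comp ht).sub_const (c * ‖w‖ ^ 2)
  refine le_of_tendsto hlim (Eventually.of_forall fun k => ?_)
  refine le_trans ?_ (hk k)
  have : 0 ≤ c * ((2 : ℝ) ^ k)⁻¹ * ‖w‖ ^ 2 := by positivity
  simp only [Function.comp, slope_def_field, zero_smul, add_zero, sub_zero]
  rw [div_inv_eq_mul]
  linarith

theorem clarkeGradient_subset [CompleteSpace E] {f : E → ℝ} {x : E} {S : Set E}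
    (hS : Convex ℝ S) (hSc : IsClosed S)
    (h : ∀ᶠ y in 𝓝 x, DifferentiableAt ℝ f y → gradient f y ∈ S) : clarkeGradient f x ⊆ S := by
  refine convexHull_min ?_ hS
  rintro v ⟨y, hd, hy, hv⟩
  exact hSc.mem_of_tendsto hv ((hy.eventually h).mono fun i hi => hi (hd i))

theorem norm_le_of_mem_clarkeGradient [CompleteSpace E] {f : E → ℝ} {x ξ : E} {U : Set E} {C : ℝ}
    (hC : 0 ≤ C) (hU : U ∈ 𝓝 x)
    (hf : ∀ y ∈ U, ∀ z ∈ U, |f y - f z| ≤ C * ‖y - z‖) (hξ : ξ ∈ clarkeGradient f x) :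
    ‖ξ‖ ≤ C := by
  have : clarkeGradient f x ⊆ Metric.closedBall 0 C := by
    refine clarkeGradient_subset (convex_closedBall _ _) Metric.isClosed_closedBall ?_
    filter_upwards [eventually_mem_nhds_iff.2 hU] with y hy hd
    have h1 := hd.hasGradientAt.hasFDerivAt.le_of_lip' hC (by
      filter_upwards [hy] with z hz
      rw [Real.norm_eq_abs]
      exact hf z hz y (mem_of_mem_nhds hy))
    rwa [mem_closedBall_zero_iff, ← (InnerProductSpace.toDual ℝ E).norm_map]
  simpa using this hξ

/-- The bound for gradients survives limits of base points by continuity, and convex hulls because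
it is a half-space condition on `ξ`. -/
theorem inner_clarkeGradient_le [CompleteSpace E] {f : E → ℝ} {Ω : Set E} {c : ℝ}
    (hΩ : Convex ℝ Ω) (hΩo : IsOpen Ω) (hc : 0 ≤ c) (hcont : ContinuousOn f Ω)
    (hf : ∀ x h : E, segment ℝ (x - h) (x + h) ⊆ Ω → -(c * ‖h‖ ^ 2) ≤ f (x + h) + f (x - h) - 2 * f x)
    {x y ξ : E} (hx : x ∈ Ω) (hy : y ∈ Ω) (hξ : ξ ∈ clarkeGradient f x) :
    (inner ℝ ξ (y - x) : ℝ) - c * ‖y - x‖ ^ 2 ≤ f y - f x := by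
  have hsub : clarkeGradient f x ⊆ {v | (inner ℝ v (y - x) : ℝ) ≤ f y - f x + c * ‖y - x‖ ^ 2} := by
    refine convexHull_min ?_ ?_
    · rintro v ⟨z, hd, hz, hv⟩
      have hl : Tendsto (fun i => (inner ℝ (gradient f (z i)) (y - z i) : ℝ)) atTop
          (𝓝 (inner ℝ v (y - x))) := hv.inner (hz.const_sub y)
      have hr : Tendsto (fun i => f y - f (z i) + c * ‖y - z i‖ ^ 2) atTop
          (𝓝 (f y - f x + c * ‖y - x‖ ^ 2)) := by
        have : Tendsto (fun i => f (z i)) atTop (𝓝 (f x)) :=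
          ((hcont.continuousAt (hΩo.mem_nhds hx)).tendsto).comp hz
        exact (this.const_sub _).add (((hz.const_sub y).norm.pow 2).const_mul c)
      refine le_of_tendsto_of_tendsto hl hr ?_
      filter_upwards [hz.eventually (hΩo.mem_nhds hx)] with i hi
      have := inner_gradient_le_of_second_difference hΩ hc hf hi hy (hd i)
      linarith
    · exact convex_halfSpace_le ⟨fun u v => inner_add_left _ _ _, fun a u => by
        simp [inner_smul_left]⟩ _
  have := hsub hξ
  simp only [mem_ofPred_eq] at this
  linarith

end Clarke

/-! ### Clarke gradient bounds for the Hamiltonian, uniform in the state. -/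

section HamiltonianClarke

variable {n : ℕ} {F : EuclideanSpace ℝ (Fin n) → Set (EuclideanSpace ℝ (Fin n))}

theorem exists_inner_clarkeGradient_le (hF : AssumptionF F) (hH : AssumptionH F)
    {R : ℝ} (hR : 0 < R) :
    ∃ c : ℝ, 0 ≤ c ∧ ∀ x ∈ Metric.ball (0 : EuclideanSpace ℝ (Fin n)) R,
      ∀ y ∈ Metric.ball (0 : EuclideanSpace ℝ (Fin n)) R, ∀ p,
      ∀ ξ ∈ clarkeGradient (fun z => maxHamiltonian F z p) x,
      (inner ℝ ξ (y - x) : ℝ) - c * ‖p‖ * ‖y - x‖ ^ 2 ≤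
        maxHamiltonian F y p - maxHamiltonian F x p := by
  obtain ⟨c, hc, h⟩ := hH.semiconvex R hR
  obtain ⟨L, hL, hlip⟩ := hF.exists_lipschitz_maxHamiltonian R
  refine ⟨c, hc, fun x hx y hy p ξ hξ => ?_⟩
  refine inner_clarkeGradient_le (convex_ball 0 R) Metric.isOpen_ball (by positivity) ?_ ?_
    hx hy hξ
  · refine (LipschitzOnWith.of_dist_le_mul (K := (L * ‖p‖).toNNReal)
      fun u hu v hv => ?_).continuousOn
    rw [Real.dist_eq, dist_eq_norm, Real.coe_toNNReal _ (by positivity)]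
    exact hlip u (Metric.ball_subset_closedBall hu) v (Metric.ball_subset_closedBall hv) p
  · intro u k hseg
    -- Semiconvexity is assumed for unit `p` only; positive homogeneity turns the constant into `c *
    -- ‖p‖`.
    rcases eq_or_ne p 0 with rfl | hp
    · have h0 : ∀ z, maxHamiltonian F z 0 = 0 := fun z => by
        simpa using hF.maxHamiltonian_smul z 0 le_rfl
      simp [h0]
    · have hp' : 0 < ‖p‖ := norm_pos_iff.2 hp
      have h1 := (h (‖p‖⁻¹ • p) (by simp [norm_smul, hp'.ne'])).2 u k hseg
      have h2 : ∀ z, maxHamiltonian F z p = ‖p‖ * maxHamiltonian F z (‖p‖⁻¹ • p) := fun z => by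
        rw [← hF.maxHamiltonian_smul z _ hp'.le, smul_smul, mul_inv_cancel₀ hp'.ne', one_smul]
      simp only [h2 (u + k), h2 (u - k), h2 u]
      nlinarith

theorem exists_norm_clarkeGradient_le (hF : AssumptionF F) (R : ℝ) :
    ∃ L : ℝ, 0 ≤ L ∧ ∀ x ∈ Metric.ball (0 : EuclideanSpace ℝ (Fin n)) R, ∀ p,
      ∀ ξ ∈ clarkeGradient (fun z => maxHamiltonian F z p) x, ‖ξ‖ ≤ L * ‖p‖ := by
  obtain ⟨L, hL, hlip⟩ := hF.exists_lipschitz_maxHamiltonian R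
  refine ⟨L, hL, fun x hx p ξ hξ => ?_⟩
  exact norm_le_of_mem_clarkeGradient (by positivity) (Metric.isOpen_ball.mem_nhds hx)
    (fun y hy z hz => hlip y (Metric.ball_subset_closedBall hy) z
      (Metric.ball_subset_closedBall hz) p) hξ

end HamiltonianClarke

/-! ### Trajectories and dynamic programming. -/

section Trajectories

variable {n : ℕ} {F : EuclideanSpace ℝ (Fin n) → Set (EuclideanSpace ℝ (Fin n))}
  {K : Set (EuclideanSpace ℝ (Fin n))} {x y z : ℝ → EuclideanSpace ℝ (Fin n)} {T : ℝ}

theorem isTrajectory_iff : IsTrajectory F T x ↔ AbsolutelyContinuousOnInterval x 0 T ∧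
    ∀ᵐ t, t ∈ Icc 0 T → ∃ v ∈ F (x t), HasDerivAt x v t := by
  rw [IsTrajectory, ae_restrict_iff' measurableSet_Icc]

theorem absolutelyContinuousOnInterval_of_norm_sub_le {E : Type*} [NormedAddCommGroup E]
    {f : ℝ → E} {a b C : ℝ} (hab : a ≤ b)
    (h : ∀ s ∈ Icc a b, ∀ t ∈ Icc a b, ‖f s - f t‖ ≤ C * |s - t|) :
    AbsolutelyContinuousOnInterval f a b := by
  have hid : AbsolutelyContinuousOnInterval (fun s : ℝ => s) a b :=
    absolutelyContinuousOnInterval_of_contDiff contDiff_id a b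
  refine absolutelyContinuousOnInterval_of_dist_le (A := C) (B := 0) hid hid fun s hs t ht => ?_
  rw [uIcc_of_le hab] at hs ht
  rw [dist_eq_norm, Real.dist_eq, zero_mul, add_zero]
  exact h s hs t ht

theorem IsTrajectory.exists_lipschitz (hF : AssumptionF F) (hT : 0 ≤ T)
    (hx : IsTrajectory F T x) :
    ∃ C : ℝ, 0 ≤ C ∧ ∀ s ∈ Icc 0 T, ∀ t ∈ Icc 0 T, ‖x s - x t‖ ≤ C * |s - t| := by
  obtain ⟨hac, hd⟩ := isTrajectory_iff.1 hx
  obtain ⟨B, hB⟩ := hac.exists_bound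
  obtain ⟨M, hM0, hM⟩ := hF.exists_norm_bound B
  have hd' : ∀ᵐ s, s ∈ Icc 0 T → ∃ v, ‖v‖ ≤ M ∧ HasDerivAt x v s := by
    filter_upwards [hd] with s hs hsI
    obtain ⟨v, hv, hv'⟩ := hs hsI
    refine ⟨v, hM _ ?_ v hv, hv'⟩
    rw [← uIcc_of_le hT] at hsI
    simpa using hB s hsI
  refine ⟨M, hM0, fun s hs t ht => ?_⟩
  rcases le_total s t with hst | hst
  · rw [norm_sub_rev, abs_sub_comm, abs_of_nonneg (sub_nonneg.2 hst)]
    exact norm_sub_le_of_ae_hasDerivAt hM0 hac hd' hs.1 hst ht.2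
  · rw [abs_of_nonneg (sub_nonneg.2 hst)]
    exact norm_sub_le_of_ae_hasDerivAt hM0 hac hd' ht.1 hst hs.2

theorem IsTrajectory.restrict (hx : IsTrajectory F T x) {t : ℝ} (ht : 0 ≤ t) (htT : t ≤ T) :
    IsTrajectory F t x := by
  obtain ⟨hac, hd⟩ := isTrajectory_iff.1 hx
  have hsub : Icc 0 t ⊆ Icc 0 T := Icc_subset_Icc_right htT
  refine isTrajectory_iff.2 ⟨hac.mono ?_, hd.mono fun s hs hsI => hs (hsub hsI)⟩
  rwa [uIcc_of_le ht, uIcc_of_le (ht.trans htT)]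

theorem IsTrajectory.shift (hF : AssumptionF F) (hx : IsTrajectory F T x) {t : ℝ} (ht : 0 ≤ t)
    (htT : t ≤ T) : IsTrajectory F (T - t) (fun s => x (s + t)) := by
  obtain ⟨hac, hd⟩ := isTrajectory_iff.1 hx
  obtain ⟨C, -, hC⟩ := hx.exists_lipschitz hF (ht.trans htT)
  have hmem : ∀ s ∈ Icc 0 (T - t), s + t ∈ Icc 0 T := fun s hs =>
    ⟨by linarith [hs.1], by linarith [hs.2]⟩
  refine isTrajectory_iff.2 ⟨absolutelyContinuousOnInterval_of_norm_sub_le (by linarith)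
    (C := C) fun s hs r hr => ?_, ?_⟩
  · simpa using hC _ (hmem s hs) _ (hmem r hr)
  · filter_upwards [(measurePreserving_add_right volume t).quasiMeasurePreserving.ae hd]
      with s hs hsI
    obtain ⟨v, hv, hv'⟩ := hs (hmem s hsI)
    exact ⟨v, hv, hv'.comp_add_const s t⟩

/-- The min/max formula glues without a case split, so the Lipschitz constants simply add; the
inclusion is checked off the null set `{t}`. -/
theorem IsTrajectory.concat (hF : AssumptionF F) {t T' : ℝ} (ht : 0 ≤ t) (hT' : 0 ≤ T')
    (hy : IsTrajectory F t y) (hz : IsTrajectory F T' z) (hyz : z 0 = y t) :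
    IsTrajectory F (t + T') (fun s => y (min s t) + (z (max s t - t) - y t)) := by
  obtain ⟨C, hC0, hC⟩ := hy.exists_lipschitz hF ht
  obtain ⟨D, hD0, hD⟩ := hz.exists_lipschitz hF hT'
  have hmin : ∀ s ∈ Icc 0 (t + T'), min s t ∈ Icc 0 t := fun s hs =>
    ⟨le_min hs.1 ht, min_le_right _ _⟩
  have hmax : ∀ s ∈ Icc 0 (t + T'), max s t - t ∈ Icc 0 T' := fun s hs =>
    ⟨sub_nonneg.2 (le_max_right _ _), by
      have : max s t ≤ t + T' := max_le hs.2 (by linarith)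
      linarith⟩
  refine isTrajectory_iff.2 ⟨absolutelyContinuousOnInterval_of_norm_sub_le (by linarith)
    (C := C + D) fun s hs r hr => ?_, ?_⟩
  · have h1 := hC _ (hmin s hs) _ (hmin r hr)
    have h2 := hD _ (hmax s hs) _ (hmax r hr)
    have h3 : |min s t - min r t| ≤ |s - r| := by
      simpa using abs_min_sub_min_le_max s t r t
    have h4 : |max s t - t - (max r t - t)| ≤ |s - r| := by
      simpa using abs_max_sub_max_le_max s t r t
    have h5 : y (min s t) + (z (max s t - t) - y t) - (y (min r t) + (z (max r t - t) - y t)) =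
      (y (min s t) - y (min r t)) + (z (max s t - t) - z (max r t - t)) := by abel
    rw [h5, add_mul]
    refine (norm_add_le _ _).trans (add_le_add (h1.trans ?_) (h2.trans ?_)) <;> gcongr
  · filter_upwards [(isTrajectory_iff.1 hy).2,
      (measurePreserving_sub_right volume t).quasiMeasurePreserving.ae (isTrajectory_iff.1 hz).2,
      compl_mem_ae_iff.2 (measure_singleton t)] with s h1 h2 hst hs
    rcases lt_or_gt_of_ne (show s ≠ t from hst) with hlt | hlt
    · obtain ⟨v, hv, hv'⟩ := h1 ⟨hs.1, hlt.le⟩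
      refine ⟨v, ?_, hv'.congr_of_eventuallyEq ?_⟩
      · simpa [hlt.le, hyz] using hv
      · filter_upwards [Iio_mem_nhds hlt] with r hr
        simp [(mem_Iio.1 hr).le, hyz]
    · obtain ⟨v, hv, hv'⟩ := h2 ⟨by linarith, by linarith [hs.2]⟩
      refine ⟨v, ?_, (hv'.comp_sub_const s t).congr_of_eventuallyEq ?_⟩
      · simpa [hlt.le] using hv
      · filter_upwards [Ioi_mem_nhds hlt] with r hr
        simp [(mem_Ioi.1 hr).le]

theorem minTime_of_mem {a : EuclideanSpace ℝ (Fin n)} (ha : a ∈ K) : minTime F K a = 0 := by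
  simp [minTime, ha]

theorem IsTrajectory.minTime_le (hz : IsTrajectory F T z) (hT : 0 ≤ T) (hzK : z T ∈ K) :
    minTime F K (z 0) ≤ ENNReal.ofReal T := by
  by_cases h0 : z 0 ∈ K
  · simp [minTime_of_mem h0]
  · have hT' : 0 < T := hT.lt_of_ne (by rintro rfl; exact h0 hzK)
    rw [minTime, if_neg h0]
    exact sInf_le ⟨T, hT', rfl, z, hz, rfl, hzK⟩

/-- Dynamic programming: `y` is prolonged by any trajectory leading from `y t` to the target. -/
theorem IsTrajectory.minTime_le_add (hF : AssumptionF F) {t : ℝ} (ht : 0 ≤ t)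
    (hy : IsTrajectory F t y) :
    minTime F K (y 0) ≤ ENNReal.ofReal t + minTime F K (y t) := by
  by_cases h1 : y t ∈ K
  · simpa [minTime_of_mem h1] using hy.minTime_le ht h1
  · rw [show minTime F K (y t) = _ from if_neg h1, ENNReal.add_sInf]
    refine le_iInf₂ ?_
    rintro _ ⟨T', hT', rfl, z, hz, hz0, hzK⟩
    rw [← ENNReal.ofReal_add ht hT'.le]
    have := (hy.concat hF ht hT'.le hz hz0).minTime_le (K := K) (by linarith)
      (by simpa [hT'.le] using hzK)
    simpa [ht, hz0] using this

/-- The tail of the trajectory gives the upper bound, dynamic programming on its initial piece the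
lower one. -/
theorem IsOptimalTrajectory.minTime_eq (hF : AssumptionF F) {x₀ : EuclideanSpace ℝ (Fin n)}
    (hfin : minTime F K x₀ ≠ ⊤) (hx : IsOptimalTrajectory F K x₀ x) {t : ℝ} (ht : 0 ≤ t)
    (htT : t ≤ (minTime F K x₀).toReal) :
    minTime F K (x t) = ENNReal.ofReal ((minTime F K x₀).toReal - t) := by
  obtain ⟨hx, hx0, hxK⟩ := hx
  refine le_antisymm ?_ ?_
  · simpa using (hx.shift hF ht htT).minTime_le (K := K) (by linarith) (by simpa using hxK)
  · have := (hx.restrict ht htT).minTime_le_add (K := K) hF ht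
    rw [hx0] at this
    rw [ENNReal.ofReal_sub _ ht, ENNReal.ofReal_toReal hfin]
    exact tsub_le_iff_left.2 this

end Trajectories

/-! ### Truncation and backward solvability of the flow. -/

section Flow

variable {n : ℕ}

/-- The projection of `x` to the cube `[-R, R]ⁿ`. -/
def cubeProj (R : ℝ) (x : EuclideanSpace ℝ (Fin n)) : EuclideanSpace ℝ (Fin n) :=
  WithLp.toLp 2 fun i => max (-R) (min R (x i))

/-- Being nonexpansive with bounded range, the truncation turns the local Lipschitz bound on `∇_p H`
into a global one. -/
theorem norm_cubeProj_sub_le (R : ℝ) (x y : EuclideanSpace ℝ (Fin n)) :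
    ‖cubeProj R x - cubeProj R y‖ ≤ ‖x - y‖ := by
  rw [EuclideanSpace.norm_eq, EuclideanSpace.norm_eq]
  refine Real.sqrt_le_sqrt (Finset.sum_le_sum fun i _ => ?_)
  have h1 : |max (-R) (min R (x i)) - max (-R) (min R (y i))| ≤ |min R (x i) - min R (y i)| := by
    simpa using abs_max_sub_max_le_max (-R) (min R (x i)) (-R) (min R (y i))
  have h2 : |min R (x i) - min R (y i)| ≤ |x i - y i| := by
    simpa using abs_min_sub_min_le_max R (x i) R (y i)
  simpa [cubeProj] using sq_le_sq.2 (h1.trans h2)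

theorem cubeProj_of_norm_le {R : ℝ} {x : EuclideanSpace ℝ (Fin n)} (hx : ‖x‖ ≤ R) :
    cubeProj R x = x := by
  ext i
  have h := (PiLp.norm_apply_le x i).trans hx
  rw [Real.norm_eq_abs, abs_le] at h
  simp [cubeProj, h.1, h.2]

theorem norm_cubeProj_le {R : ℝ} (hR : 0 ≤ R) (x : EuclideanSpace ℝ (Fin n)) :
    ‖cubeProj R x‖ ≤ Real.sqrt n * R := by
  have h : Real.sqrt n * R = Real.sqrt (n * R ^ 2) := by
    rw [Real.sqrt_mul (by positivity), Real.sqrt_sq hR]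
  rw [EuclideanSpace.norm_eq, h]
  refine Real.sqrt_le_sqrt ?_
  have : ∀ i : Fin n, ‖cubeProj R x i‖ ^ 2 ≤ R ^ 2 := fun i => by
    rw [Real.norm_eq_abs, sq_abs]
    refine sq_le_sq.2 ?_
    rw [abs_of_nonneg hR, abs_le]
    exact ⟨le_max_left _ _, max_le (by linarith) (min_le_left _ _)⟩
  simpa using Finset.sum_le_sum (s := Finset.univ) fun i _ => this i

/-- A bounded, globally Lipschitz field has a solution on `[0, t]` with any value prescribed at
time `t`. -/
theorem exists_backward_solution {E : Type*} [NormedAddCommGroup E] [NormedSpace ℝ E]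
    [CompleteSpace E] {V : ℝ → E → E} {t K M : ℝ} (ht : 0 ≤ t) (hK : 0 ≤ K) (hM : 0 ≤ M)
    (hlip : ∀ s ∈ Icc 0 t, ∀ u v, ‖V s u - V s v‖ ≤ K * ‖u - v‖)
    (hcont : ∀ u, ContinuousOn (fun s => V s u) (Icc 0 t))
    (hbd : ∀ s ∈ Icc 0 t, ∀ u, ‖V s u‖ ≤ M) (y₀ : E) :
    ∃ y : ℝ → E, y t = y₀ ∧ (∀ s ∈ Icc 0 t, ∀ r ∈ Icc 0 t, ‖y s - y r‖ ≤ M * |s - r|) ∧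
      ∀ s ∈ Ioo 0 t, HasDerivAt y (V s (y s)) s := by
  -- The base time is the right endpoint, and the radius `M * t` is what speed `M` can cover, so the
  -- solution exists on all of `[0, t]`.
  have hPL : IsPicardLindelof V (tmin := 0) (tmax := t) ⟨t, ht, le_rfl⟩ y₀
      (M * t).toNNReal 0 M.toNNReal K.toNNReal :=
    { lipschitzOnWith := fun s hs => LipschitzOnWith.of_dist_le_mul fun u _ v _ => by
        rw [dist_eq_norm, dist_eq_norm, Real.coe_toNNReal _ hK]
        exact hlip s hs u v
      continuousOn := fun u _ => hcont u
      norm_le := fun s hs u _ => by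
        rw [Real.coe_toNNReal _ hM]
        exact hbd s hs u
      mul_max_le := by
        rw [Real.coe_toNNReal _ hM, Real.coe_toNNReal _ (by positivity)]
        simp [ht] }
  obtain ⟨y, hy, hd⟩ := hPL.exists_eq_forall_mem_Icc_hasDerivWithinAt₀
  refine ⟨y, hy, fun s hs r hr => ?_, fun s hs => ?_⟩
  · exact (convex_Icc 0 t).norm_image_sub_le_of_norm_hasDerivWithin_le hd
      (fun u hu => hbd u hu _) hr hs
  · exact (hd s (Ioo_subset_Icc_self hs)).hasDerivAt (Icc_mem_nhds hs.1 hs.2)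

end Flow

/-! ### The Hamiltonian inclusion: adjoint arc, constancy of `H`, comparison trajectories. -/

section HamiltonianInclusion

variable {n : ℕ} {F : EuclideanSpace ℝ (Fin n) → Set (EuclideanSpace ℝ (Fin n))}
  {x p : ℝ → EuclideanSpace ℝ (Fin n)} {T : ℝ}

theorem SolvesHamiltonianInclusion.ae (h : SolvesHamiltonianInclusion F T x p) :
    ∀ᵐ s, s ∈ Icc 0 T → (p s ≠ 0 → HasDerivAt x (gradient (maxHamiltonian F (x s)) (p s)) s) ∧
      ∃ q, HasDerivAt p q s ∧ -q ∈ clarkeGradient (fun z => maxHamiltonian F z (p s)) (x s) :=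
  (ae_restrict_iff' measurableSet_Icc).1 h.2.2

theorem SolvesHamiltonianInclusion.exists_mem_ball (h : SolvesHamiltonianInclusion F T x p)
    (hT : 0 ≤ T) : ∃ R, 0 ≤ R ∧ ∀ s ∈ Icc 0 T, ‖x s‖ ≤ R := by
  obtain ⟨B, hB⟩ := h.1.exists_bound
  rw [uIcc_of_le hT] at hB
  exact ⟨B, (norm_nonneg _).trans (hB 0 ⟨le_rfl, hT⟩), hB⟩

/-- The adjoint arc vanishes identically or nowhere. -/
theorem SolvesHamiltonianInclusion.eq_zero_iff (hF : AssumptionF F)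
    (h : SolvesHamiltonianInclusion F T x p) {t : ℝ} (ht : t ∈ Icc 0 T) : p t = 0 ↔ p 0 = 0 := by
  obtain ⟨R, -, hR⟩ := h.exists_mem_ball (ht.1.trans ht.2)
  obtain ⟨L, hL0, hL⟩ := exists_norm_clarkeGradient_le hF (R + 1)
  -- The two-sided bound lets Grönwall run in both time directions, one for each implication.
  have hd : ∀ᵐ s, s ∈ Icc 0 T → ∃ q, HasDerivAt p q s ∧ |inner ℝ (p s) q| ≤ L * ‖p s‖ ^ 2 := by
    filter_upwards [h.ae] with s hs hsI
    obtain ⟨-, q, hq, hq'⟩ := hs hsI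
    have h1 := hL (x s) (by simpa using (hR s hsI).trans_lt (lt_add_one R)) _ _ hq'
    rw [norm_neg] at h1
    refine ⟨q, hq, (abs_real_inner_le_norm _ _).trans ?_⟩
    nlinarith [norm_nonneg (p s)]
  have key : ∀ {a b : EuclideanSpace ℝ (Fin n)} {u v : ℝ}, b = 0 →
      Real.exp u * ‖a‖ ^ 2 ≤ Real.exp v * ‖b‖ ^ 2 → a = 0 := fun {a b u v} hb hab => by
    simp only [hb, norm_zero, ne_eq, OfNat.ofNat_ne_zero, not_false_eq_true, zero_pow,
      mul_zero] at hab
    have h2 := nonpos_of_mul_nonpos_right hab (Real.exp_pos u)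
    simpa using le_antisymm h2 (by positivity)
  constructor
  · intro h0
    have := norm_sq_mul_exp_le (C := L) (σ := 1) h.2.1 (hd.mono fun s hs hsI => by
      obtain ⟨q, hq, hle⟩ := hs hsI
      exact ⟨q, hq, by linarith [(abs_le.1 hle).1]⟩) le_rfl ht.1 ht.2
    rw [one_mul, one_mul] at this
    exact key h0 this
  · intro h0
    have := norm_sq_mul_exp_le (C := -L) (σ := -1) h.2.1 (hd.mono fun s hs hsI => by
      obtain ⟨q, hq, hle⟩ := hs hsI
      exact ⟨q, hq, by linarith [(abs_le.1 hle).2]⟩) le_rfl ht.1 ht.2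
    rw [neg_one_mul, neg_one_mul, neg_le_neg_iff] at this
    exact key h0 this

/-- The Hamiltonian is constant along solutions of the Hamiltonian inclusion. -/
theorem SolvesHamiltonianInclusion.maxHamiltonian_eq (hF : AssumptionF F) (hH : AssumptionH F)
    (h : SolvesHamiltonianInclusion F T x p) (hp : ∀ s ∈ Icc 0 T, p s ≠ 0) {t : ℝ}
    (ht : t ∈ Icc 0 T) : maxHamiltonian F (x t) (p t) = maxHamiltonian F (x 0) (p 0) := by
  have hT : 0 ≤ T := ht.1.trans ht.2
  obtain ⟨R, hR0, hR⟩ := h.exists_mem_ball hT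
  obtain ⟨P, hP⟩ := h.2.1.exists_bound
  obtain ⟨L, hL0, hL⟩ := hF.exists_lipschitz_maxHamiltonian R
  obtain ⟨M, hM0, hM⟩ := hF.exists_norm_bound R
  obtain ⟨G, hG0, hG⟩ := hH.lipschitz_gradient (R + 1) (by linarith)
  obtain ⟨c, hc0, hc⟩ := exists_inner_clarkeGradient_le hF hH (R := R + 1) (by linarith)
  have hac : AbsolutelyContinuousOnInterval (fun s => maxHamiltonian F (x s) (p s)) 0 T := by
    refine absolutelyContinuousOnInterval_of_dist_le (A := L * P) (B := M) h.1 h.2.1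
      fun s hs r hr => ?_
    have hPs := hP s hs
    rw [uIcc_of_le hT] at hs hr
    have hxs : x s ∈ Metric.closedBall 0 R := by simpa using hR s hs
    have hxr : x r ∈ Metric.closedBall 0 R := by simpa using hR r hr
    rw [Real.dist_eq, dist_eq_norm, dist_eq_norm]
    refine (abs_sub_le _ (maxHamiltonian F (x r) (p s)) _).trans (add_le_add ?_ ?_)
    · exact (hL _ hxs _ hxr _).trans (by gcongr)
    · exact hF.abs_maxHamiltonian_sub_le_right (hM _ hxr) _ _
  obtain ⟨C, hC⟩ := hac.const_of_ae_hasDerivAt_zero (by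
    rw [uIcc_of_le hT]
    filter_upwards [h.ae, hac.ae_differentiableAt] with s hs hds hsI
    obtain ⟨hxd, q, hq, hqc⟩ := hs hsI
    have hps := hp s hsI
    replace hxd := hxd hps
    have hg := (hds (by rwa [uIcc_of_le hT])).hasDerivAt
    set w := gradient (maxHamiltonian F (x s)) (p s) with hw
    have hxs : x s ∈ Metric.ball 0 (R + 1) := by
      simpa using (hR s hsI).trans_lt (lt_add_one R)
    -- Only a first-order lower bound for `H` at `(x s, p s)` is available, from semiconvexity in
    -- `x` and a supporting vector of `F (x r)` in `p`. It suffices: the quadratic terms have zero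
    -- derivative at `s`, and the linear ones cancel since `x` and `p` have derivatives `w` and `q`.
    have hmin : IsLocalMin (fun r => maxHamiltonian F (x r) (p r) - inner ℝ w (p r) +
        inner ℝ q (x r) + (c * ‖p s‖ + G) * ‖x r - x s‖ ^ 2 + G * ‖p r - p s‖ ^ 2) s := by
      filter_upwards [hxd.continuousAt.eventually (Metric.isOpen_ball.mem_nhds hxs)] with r hr
      have h1 := hc _ hxs _ hr _ _ hqc
      have h2 := hF.inner_le_maxHamiltonian (gradient_mem hF hH (x r) hps) (p r)
      have h3 := inner_gradient_self hF hH (x r) hps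
      have h4 := hG _ hps _ hr _ hxs
      set w' := gradient (maxHamiltonian F (x r)) (p s)
      have h5 : |inner ℝ (w' - w) (p r - p s)| ≤ G * ‖x r - x s‖ * ‖p r - p s‖ :=
        (abs_real_inner_le_norm _ _).trans (by gcongr)
      have h6 := (abs_le.1 h5).1
      have h7 : G * ‖x r - x s‖ * ‖p r - p s‖ ≤ G * (‖x r - x s‖ ^ 2 + ‖p r - p s‖ ^ 2) := by
        rw [mul_assoc]
        refine mul_le_mul_of_nonneg_left ?_ hG0
        nlinarith [sq_nonneg (‖x r - x s‖ - ‖p r - p s‖), sq_nonneg (‖x r - x s‖ + ‖p r - p s‖)]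
      simp only [inner_sub_left, inner_sub_right, inner_neg_left] at h1 h6
      simp only [sub_self, norm_zero, ne_eq, OfNat.ofNat_ne_zero, not_false_eq_true, zero_pow,
        mul_zero, add_zero]
      linarith
    have hsq : ∀ {f : ℝ → EuclideanSpace ℝ (Fin n)} {v : EuclideanSpace ℝ (Fin n)},
        HasDerivAt f v s → HasDerivAt (fun r => ‖f r - f s‖ ^ 2) 0 s := fun {f v} hf => by
      simpa using (hf.sub_const (f s)).norm_sq
    have hder := (((hg.sub ((hasDerivAt_const s w).inner ℝ hq)).add
      ((hasDerivAt_const s q).inner ℝ hxd)).add ((hsq hxd).const_mul (c * ‖p s‖ + G))).add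
      ((hsq hq).const_mul G)
    have h0 := hmin.hasDerivAt_eq_zero hder
    have h1 : deriv (fun s => maxHamiltonian F (x s) (p s)) s = 0 := by
      simp only [inner_zero_left, mul_zero, add_zero] at h0
      rw [real_inner_comm] at h0
      linarith
    rwa [h1] at hg)
  rw [uIcc_of_le hT] at hC
  exact (hC t ht).trans (hC 0 ⟨le_rfl, hT⟩).symm

/-- Every point near `x t` is the endpoint of a trajectory on `[0, t]` along which the pairing
with the adjoint arc changes at most quadratically. -/
theorem SolvesHamiltonianInclusion.exists_trajectory (hF : AssumptionF F) (hH : AssumptionH F)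
    (h : SolvesHamiltonianInclusion F T x p) (hp : ∀ s ∈ Icc 0 T, p s ≠ 0) {t : ℝ}
    (ht : t ∈ Icc 0 T) :
    ∃ δ C : ℝ, 0 < δ ∧ 0 ≤ C ∧ ∀ y₀, ‖y₀ - x t‖ ≤ δ → ∃ y, IsTrajectory F t y ∧ y t = y₀ ∧
      ‖y 0 - x 0‖ ^ 2 ≤ C * ‖y₀ - x t‖ ^ 2 ∧
      inner ℝ (-p t) (y₀ - x t) ≤ inner ℝ (-p 0) (y 0 - x 0) + C * ‖y₀ - x t‖ ^ 2 := by
  have hT : 0 ≤ T := ht.1.trans ht.2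
  have hsub : Icc 0 t ⊆ Icc 0 T := Icc_subset_Icc_right ht.2
  obtain ⟨B, hB0, hB⟩ := h.exists_mem_ball hT
  obtain ⟨P, hP⟩ := h.2.1.exists_bound
  rw [uIcc_of_le hT] at hP
  have hP0 : 0 ≤ P := (norm_nonneg _).trans (hP 0 ⟨le_rfl, hT⟩)
  set R := B + 1 with hRdef
  have hR0 : 0 < R := by linarith
  -- Large enough for the ball to contain both the cube `[-R, R]ⁿ` and the closed ball of radius
  -- `R`.
  set R' := Real.sqrt n * R + R + 1 with hR'def
  have hR'0 : 0 < R' := by positivity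
  obtain ⟨K, hK0, hK⟩ := hH.lipschitz_gradient R' hR'0
  obtain ⟨M, hM0, hM⟩ := hF.exists_norm_bound R'
  obtain ⟨c, hc0, hc⟩ := exists_inner_clarkeGradient_le hF hH hR'0
  have hball : ∀ {u : EuclideanSpace ℝ (Fin n)}, ‖u‖ ≤ R → u ∈ Metric.ball 0 R' := fun {u} hu => by
    have : 0 ≤ Real.sqrt n * R := by positivity
    rw [mem_ball_zero_iff]; linarith
  have hcube : ∀ u : EuclideanSpace ℝ (Fin n), cubeProj R u ∈ Metric.ball 0 R' := fun u => by
    have := norm_cubeProj_le hR0.le u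
    rw [mem_ball_zero_iff]; linarith
  set D := c * P * Real.exp (2 * K * t) with hD
  have hD0 : 0 ≤ D := by positivity
  -- With this `δ`, Grönwall keeps `‖y s - x s‖ ≤ 1`, so `y` stays within radius `R = B + 1`, where
  -- the truncation is the identity. `D` bounds the loss rate `c ‖p‖ ‖y - x‖²` per unit of `‖y₀ - x
  -- t‖²`.
  refine ⟨Real.exp (-(K * t)), max (Real.exp (2 * K * t)) (D * t), Real.exp_pos _,
    le_max_of_le_left (Real.exp_pos _).le, fun y₀ hy₀ => ?_⟩
  obtain ⟨y, hyt, hylip, hyd⟩ := exists_backward_solution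
    (V := fun s u => gradient (maxHamiltonian F (cubeProj R u)) (p s)) ht.1 hK0 hM0
    (fun s hs u v => (hK _ (hp s (hsub hs)) _ (hcube u) _ (hcube v)).trans
      (mul_le_mul_of_nonneg_left (norm_cubeProj_sub_le R u v) hK0))
    (fun u s hs => (continuousAt_gradient hF hH _ (hp s (hsub hs))).comp_continuousWithinAt
      (((uIcc_of_le hT ▸ h.2.1.continuousOn).mono hsub) s hs))
    (fun s hs u => hM _ (Metric.ball_subset_closedBall (hcube u)) _
      (gradient_mem hF hH _ (hp s (hsub hs)))) y₀
  have hyac : AbsolutelyContinuousOnInterval y 0 t :=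
    absolutelyContinuousOnInterval_of_norm_sub_le ht.1 hylip
  have hsub' : uIcc 0 t ⊆ uIcc 0 T := by rwa [uIcc_of_le ht.1, uIcc_of_le hT]
  have hxac : AbsolutelyContinuousOnInterval x 0 t := h.1.mono hsub'
  have hpac : AbsolutelyContinuousOnInterval p 0 t := h.2.1.mono hsub'
  have hae : ∀ᵐ s, s ∈ Icc 0 t → s ∈ Ioo 0 t := by
    filter_upwards [compl_mem_ae_iff.2 (measure_singleton (0 : ℝ)),
      compl_mem_ae_iff.2 (measure_singleton t)] with s h0 h1 hs
    exact ⟨hs.1.lt_of_ne (Ne.symm h0), hs.2.lt_of_ne h1⟩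
  have hzac := hyac.sub hxac
  have hz : ∀ s ∈ Icc 0 t, ‖y s - x s‖ ^ 2 ≤ Real.exp (2 * K * t) * ‖y₀ - x t‖ ^ 2 := by
    intro s hs
    have := norm_sq_mul_exp_le (C := K) (σ := 1) hzac (by
      filter_upwards [h.ae, hae] with r hr hr' hrI
      refine ⟨_, (hyd r (hr' hrI)).sub ((hr (hsub hrI)).1 (hp r (hsub hrI))), ?_⟩
      have hx : cubeProj R (x r) = x r :=
        cubeProj_of_norm_le ((hB r (hsub hrI)).trans (by linarith))
      have h1 := hK _ (hp r (hsub hrI)) _ (hcube (y r)) _ (hcube (x r))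
      have h2 := norm_cubeProj_sub_le R (y r) (x r)
      rw [hx] at h1 h2
      have h3 : |inner ℝ (y r - x r) (gradient (maxHamiltonian F (cubeProj R (y r))) (p r) -
          gradient (maxHamiltonian F (x r)) (p r))| ≤ ‖y r - x r‖ * (K * ‖y r - x r‖) :=
        (abs_real_inner_le_norm _ _).trans (mul_le_mul_of_nonneg_left
          (h1.trans (mul_le_mul_of_nonneg_left h2 hK0)) (norm_nonneg _))
      have := (abs_le.1 h3).1
      simp only [Pi.sub_apply]
      nlinarith) hs.1 hs.2 le_rfl
    simp only [one_mul, Pi.sub_apply, hyt] at this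
    refine le_trans ?_ this
    exact le_mul_of_one_le_left (by positivity) (Real.one_le_exp (by have := hs.1; positivity))
  have hyR : ∀ s ∈ Icc 0 t, ‖y s‖ ≤ R := by
    intro s hs
    have h1 : ‖y s - x s‖ ^ 2 ≤ 1 := by
      refine (hz s hs).trans ?_
      have h2 : ‖y₀ - x t‖ ^ 2 ≤ Real.exp (-(K * t)) ^ 2 :=
        pow_le_pow_left₀ (norm_nonneg _) hy₀ 2
      have h3 : Real.exp (2 * K * t) * Real.exp (-(K * t)) ^ 2 = 1 := by
        rw [sq, ← Real.exp_add, ← Real.exp_add, ← Real.exp_zero]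
        congr 1; ring
      rw [← h3]
      gcongr
    have h4 : ‖y s - x s‖ ≤ 1 := (sq_le_one_iff₀ (norm_nonneg _)).1 h1
    have h5 := norm_le_norm_sub_add (y s) (x s)
    have := hB s (hsub hs)
    linarith
  have hcy : ∀ s ∈ Icc 0 t, cubeProj R (y s) = y s := fun s hs => cubeProj_of_norm_le (hyR s hs)
  have hyd' : ∀ᵐ s, s ∈ Icc 0 t →
      HasDerivAt y (gradient (maxHamiltonian F (y s)) (p s)) s := by
    filter_upwards [hae] with s hs hsI
    have := hyd s (hs hsI)
    rwa [hcy s hsI] at this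
  refine ⟨y, isTrajectory_iff.2 ⟨hyac, ?_⟩, hyt, ?_, ?_⟩
  · filter_upwards [hyd'] with s hs hsI
    exact ⟨_, gradient_mem hF hH _ (hp s (hsub hsI)), hs hsI⟩
  · exact (hz 0 ⟨le_rfl, ht.1⟩).trans
      (mul_le_mul_of_nonneg_right (le_max_left _ _) (by positivity))
  · set E := D * ‖y₀ - x t‖ ^ 2 with hE
    have hac1 := absolutelyContinuousOnInterval_inner hpac hzac
    have hac2 : AbsolutelyContinuousOnInterval (fun s : ℝ => E * s) 0 t :=
      absolutelyContinuousOnInterval_of_contDiff (by fun_prop) 0 t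
    -- The function `⟨p, y - x⟩ + E s` is nondecreasing: semiconvexity absorbs `⟨q, y - x⟩` into the
    -- change of `H`, up to `E`.
    have key := le_of_ae_hasDerivAt_nonneg ht.1 (hac1.fun_add hac2) (by
        filter_upwards [h.ae, hyd'] with s hs hys hsI
        obtain ⟨hxd, q, hq, hqc⟩ := hs (hsub hsI)
        have hps := hp s (hsub hsI)
        have hd1 := hq.inner ℝ ((hys hsI).sub (hxd hps))
        have hd2 := (hasDerivAt_id s).const_mul E
        refine ⟨_, ?_, hd1.fun_add hd2⟩
        have h1 := hc _ (hball ((hB s (hsub hsI)).trans (by linarith))) _ (hball (hyR s hsI))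
          _ _ hqc
        have h2 := inner_gradient_self hF hH (x s) hps
        have h3 := inner_gradient_self hF hH (y s) hps
        have h4 : c * ‖p s‖ * ‖y s - x s‖ ^ 2 ≤ E := by
          rw [hE, hD, mul_assoc (c * P)]
          exact mul_le_mul (mul_le_mul_of_nonneg_left (hP s (hsub hsI)) hc0) (hz s hsI)
            (by positivity) (by positivity)
        rw [inner_neg_left] at h1
        rw [inner_sub_right (p s), real_inner_comm _ (p s), real_inner_comm _ (p s), h2, h3]
        simp only [Pi.sub_apply]
        linarith)
    simp only [Pi.sub_apply, hyt, mul_zero, add_zero] at key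
    rw [inner_neg_left, inner_neg_left]
    have : D * t * ‖y₀ - x t‖ ^ 2 ≤ max (Real.exp (2 * K * t)) (D * t) * ‖y₀ - x t‖ ^ 2 :=
      mul_le_mul_of_nonneg_right (le_max_right _ _) (by positivity)
    linarith

end HamiltonianInclusion

/-! ### Proximal normals to the epigraph and the conclusion. -/

/-- The inequality defining a proximal normal has to be checked only near the base point. -/
theorem mem_proximalNormalCone_of_local {E : Type*} [NormedAddCommGroup E]
    [InnerProductSpace ℝ E] {S : Set E} {z v : E} {δ σ : ℝ} (hz : z ∈ S) (hδ : 0 < δ)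
    (h : ∀ y ∈ S, ‖y - z‖ ≤ δ → inner ℝ v (y - z) ≤ σ * ‖y - z‖ ^ 2) :
    v ∈ proximalNormalCone S z := by
  -- The constant `‖v‖ / δ` handles distances beyond `δ` by Cauchy–Schwarz.
  refine ⟨hz, max (max σ 0) (‖v‖ / δ), le_max_of_le_left (le_max_right _ _), fun y hy => ?_⟩
  rcases le_or_gt ‖y - z‖ δ with hle | hlt
  · refine (h y hy hle).trans (mul_le_mul_of_nonneg_right ?_ (by positivity))
    exact (le_max_left _ _).trans (le_max_left _ _)
  · refine (real_inner_le_norm _ _).trans ?_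
    calc ‖v‖ * ‖y - z‖ = ‖v‖ / δ * (δ * ‖y - z‖) := by field_simp
      _ ≤ ‖v‖ / δ * ‖y - z‖ ^ 2 := by
        rw [sq]; gcongr
      _ ≤ _ := by gcongr; exact le_max_right _ _

theorem toLp_mem_epigraph {E : Type*} {f : E → ENNReal} {a : E} (h : f a ≠ ⊤) :
    WithLp.toLp 2 (a, (f a).toReal) ∈ epigraph f :=
  ⟨h, le_rfl⟩

end MinTime

end

theorem mainTheorem7 {n : ℕ}
    (F : EuclideanSpace ℝ (Fin n) → Set (EuclideanSpace ℝ (Fin n)))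
    (K : Set (EuclideanSpace ℝ (Fin n)))
    (hF : MinTime.AssumptionF F) (hH : MinTime.AssumptionH F) (hK : IsClosed K)
    (x₀ : EuclideanSpace ℝ (Fin n)) (hx₀K : x₀ ∉ K) (hx₀R : MinTime.minTime F K x₀ ≠ ⊤)
    (x p : ℝ → EuclideanSpace ℝ (Fin n))
    (hx : MinTime.IsOptimalTrajectory F K x₀ x)
    (hxp : MinTime.SolvesHamiltonianInclusion F (MinTime.minTime F K x₀).toReal x p)
    (hp₀ : WithLp.toLp 2 (-p 0, MinTime.minHamiltonian F x₀ (-p 0)) ∈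
      MinTime.proximalNormalCone (MinTime.epigraph (MinTime.minTime F K))
        (WithLp.toLp 2 (x₀, (MinTime.minTime F K x₀).toReal))) :
    (∀ t ∈ Set.Ico 0 (MinTime.minTime F K x₀).toReal,
      WithLp.toLp 2 (-p t, MinTime.minHamiltonian F (x t) (-p t)) ∈
        MinTime.proximalNormalCone (MinTime.epigraph (MinTime.minTime F K))
          (WithLp.toLp 2 (x t, (MinTime.minTime F K (x t)).toReal))) ∧
    (∀ t ∈ Set.Icc 0 (MinTime.minTime F K x₀).toReal,
      MinTime.minHamiltonian F (x t) (-p t) = MinTime.minHamiltonian F x₀ (-p 0)) := by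
  open MinTime in
  set T := (minTime F K x₀).toReal with hT
  have hx0 : x 0 = x₀ := hx.2.1
  have hmin : ∀ t ∈ Set.Icc 0 T, minTime F K (x t) = ENNReal.ofReal (T - t) :=
    fun t ht => hx.minTime_eq hF hx₀R ht.1 ht.2
  -- In the degenerate case the claimed normal is the zero vector.
  by_cases hp0 : p 0 = 0
  · have hpt : ∀ t ∈ Set.Icc 0 T, p t = 0 := fun t ht => (hxp.eq_zero_iff hF ht).2 hp0
    have hh : ∀ z, minHamiltonian F z (-0) = 0 := fun z => by
      rw [hF.minHamiltonian_neg, neg_eq_zero]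
      simpa using hF.maxHamiltonian_smul z 0 le_rfl
    refine ⟨fun t ht => ?_, fun t ht => by rw [hpt t ht, hp0, hh, hh]⟩
    have ht' := Set.Ico_subset_Icc_self ht
    rw [hpt t ht', hh]
    refine ⟨toLp_mem_epigraph (by simp [hmin t ht']), 0, le_rfl, fun y _ => ?_⟩
    simp [WithLp.prod_inner_apply]
  have hpt : ∀ t ∈ Set.Icc 0 T, p t ≠ 0 := fun t ht => (hxp.eq_zero_iff hF ht).not.2 hp0
  have hconst : ∀ t ∈ Set.Icc 0 T,
      minHamiltonian F (x t) (-p t) = minHamiltonian F x₀ (-p 0) := fun t ht => by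
    rw [hF.minHamiltonian_neg, hF.minHamiltonian_neg, hxp.maxHamiltonian_eq hF hH hpt ht, hx0]
  refine ⟨fun t ht => ?_, hconst⟩
  have ht' := Set.Ico_subset_Icc_self ht
  obtain ⟨δ, C, hδ, hC, htraj⟩ := hxp.exists_trajectory hF hH hpt ht'
  obtain ⟨-, σ, hσ, hprox⟩ := hp₀
  -- The spatial part costs `σ * C` from the estimate on `y 0 - x 0` plus `C` from the pairing; the
  -- time part costs `σ`.
  refine mem_proximalNormalCone_of_local (δ := δ) (σ := σ * (C + 1) + C)
    (toLp_mem_epigraph (by simp [hmin t ht'])) hδ fun q hq hqδ => ?_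
  have hτ : (minTime F K (x t)).toReal = T - t := by
    rw [hmin t ht', ENNReal.toReal_ofReal (by linarith [ht.2])]
  rw [hconst t ht', hτ]
  rw [hτ] at hqδ
  have hn : ‖q - WithLp.toLp 2 (x t, T - t)‖ ^ 2 =
      ‖q.fst - x t‖ ^ 2 + (q.snd - (T - t)) ^ 2 := by
    simp [WithLp.prod_norm_sq_eq_of_L2]
  have hle : ‖q.fst - x t‖ ≤ δ := by
    refine le_trans ?_ hqδ
    refine le_of_sq_le_sq ?_ (norm_nonneg _)
    rw [hn]
    nlinarith [sq_nonneg (q.snd - (T - t))]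
  obtain ⟨y, hy, hyt, hy1, hy2⟩ := htraj q.fst hle
  have hyT := hy.minTime_le_add (K := K) hF ht.1
  rw [hyt] at hyT
  have hfin : ENNReal.ofReal t + minTime F K q.fst ≠ ⊤ := by simpa using hq.1
  -- Raising the height by `t` leaves the vertical displacement unchanged: `(t + β) - T = β - (T -
  -- t)`.
  have hyepi : WithLp.toLp 2 (y 0, t + q.snd) ∈ epigraph (minTime F K) := by
    refine ⟨ne_top_of_le_ne_top hfin hyT, ?_⟩
    have := ENNReal.toReal_mono hfin hyT
    rw [ENNReal.toReal_add (by simp) hq.1, ENNReal.toReal_ofReal ht.1] at this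
    exact this.trans (by simpa using hq.2)
  have hfinal := hprox _ hyepi
  have hn' : ‖WithLp.toLp 2 (y 0, t + q.snd) - WithLp.toLp 2 (x₀, T)‖ ^ 2 =
      ‖y 0 - x 0‖ ^ 2 + (q.snd - (T - t)) ^ 2 := by
    simp [WithLp.prod_norm_sq_eq_of_L2, hx0]
    ring
  rw [hn', WithLp.prod_inner_apply] at hfinal
  rw [hn, WithLp.prod_inner_apply]
  simp only [WithLp.ofLp_sub, Prod.fst_sub, Prod.snd_sub, RCLike.inner_apply, conj_trivial]
    at hfinal ⊢
  rw [← hx0] at hfinal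
  have e1 : t + q.snd - T = q.snd - (T - t) := by ring
  rw [e1] at hfinal
  have h1 : σ * ‖y 0 - x 0‖ ^ 2 ≤ σ * (C * ‖q.fst - x t‖ ^ 2) :=
    mul_le_mul_of_nonneg_left hy1 hσ
  have h2 : 0 ≤ σ * C * (q.snd - (T - t)) ^ 2 := by positivity
  have h3 : 0 ≤ C * (q.snd - (T - t)) ^ 2 := by positivity
  have h4 : 0 ≤ σ * ‖q.fst - x t‖ ^ 2 := by positivity
  rw [hx0] at hfinal hy2 h1
  change inner ℝ (-p t) (q.fst - x t) + (q.snd - (T - t)) * _ ≤ _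
  nlinarith
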